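/- A \emph{deductive system} $L=(F,\vdash)$ is a set $F$ of formulas with a relation ${\vdash}\subseteq\mathcal P(F)\times F$ such that (i) $\varphi\vdash\varphi$; (ii) $\Gamma\vdash\varphi$ implies $\Gamma\cup\Gamma'\vdash\varphi$; (iii) if $\Gamma\vdash\varphi$ and $\Delta\vdash\psi$ for all $\psi\in\Gamma$, then $\Delta\vdash\varphi$. It is \emph{finitary} if $\Gamma\vdash\varphi$ implies $\Gamma'\vdash\varphi$ for some finite $\Gamma'\subseteq\Gamma$. A \emph{conservative translation} from $(F_0,\vdash_0)$ to $(F_1,\vdash_1)$ is a map $f\colon F_0\to F_1$ such that $\Gamma\vdash_0\varphi\iff f(\Gamma)\vdash_1 f(\varphi)$ for all $\Gamma\subseteq F_0$, $\varphi\in F_0$. A system $L_1$ \emph{conservatively extends} $L_0$ if, up to a renaming of formulas, $F_0\subseteq F_1$ and the inclusion is a conservative translation. A system $L$ is \emph{universal} if every finitary deductive system over a countable set of formulas has a conservative translation into $L$. A \emph{residuated lattice} is a structure $(A,\wedge,\vee,\cdot,\to,\leftarrow,1)$ where $(A,\wedge,\vee)$ is a lattice, $(A,\cdot,1)$ is a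 monoid and $b\le a\to c\iff a\cdot b\le c\iff a\le c\leftarrow b$ for all $a,b,c\in A$; an \emph{FL-algebra} is a residuated lattice with a distinguished element $0$. Consider formulas built from countably infinitely many variables using $\wedge,\vee,\cdot,\to,\leftarrow,1,0$. For a class $K$ of FL-algebras, the logic of $K$ is given by: $\Gamma\vdash\varphi$ iff for every $A\in K$ and every valuation $w$ in $A$, if $w(\psi)\ge1$ for all $\psi\in\Gamma$, then $w(\varphi)\ge1$. Let $\mathrm{FL}$, $\mathrm{FL_e}$, $\mathrm{FL_{ew}}$ be the logics of all FL-algebras, of the commutative FL-algebras, and of the commutative FL-algebras satisfying $0\le x\le1$, respectively. Let $\mathrm{CPC}$ be the consequence relation of classical propositional logic, where $\cdot$ is read as conjunction, $\varphi\leftarrow\psi$ as $\psi\to\varphi$, $1$ as truth and $0$ as falsity. For a set $B$ of connectives, $L{\restriction}_B$ is the restriction of $L$ to the formulas built from variables using only connectives in $B$. Put $\mathrm{BCK}=\mathrm{FL_{ew}}{\restriction}_{\to}$. For deductive systems over the same set of formulas, $\subseteq$ denotes inclusion of consequence relations. \textbf{Theorem.} A deductive system is universal whenever it conservatively extends a deductive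 system $L_0$ such that \begin{enumerate} \item $\mathrm{FL}{\restriction}_{\to,\leftarrow,\wedge}\subseteq L_0\subseteq\mathrm{CPC}{\restriction}_{\to,\leftarrow,\wedge}$, or \item $\mathrm{FL_e}{\restriction}_{\to,\wedge}\subseteq L_0\subseteq\mathrm{CPC}{\restriction}_{\to,\wedge}$, or \item $\mathrm{BCK}\subseteq L_0\subseteq\mathrm{CPC}{\restriction}_{\to}$. \end{enumerate} -/

import Mathlib

universe u v

/-- A deductive system over a set `F` of formulas: a Tarski-style consequence relation. -/
structure DeductiveSystem (F : Type u) where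
  /-- `entails Γ φ` is `Γ ⊢ φ`. -/
  entails : Set F → F → Prop
  refl : ∀ φ, entails {φ} φ
  weaken : ∀ Γ Γ' φ, entails Γ φ → entails (Γ ∪ Γ') φ
  cut : ∀ Γ Δ φ, entails Γ φ → (∀ ψ ∈ Γ, entails Δ ψ) → entails Δ φ

namespace DeductiveSystem

/-- `L` is finitary. -/
def Finitary {F : Type u} (L : DeductiveSystem F) : Prop :=
  ∀ Γ φ, L.entails Γ φ → ∃ Γ' ⊆ Γ, Γ'.Finite ∧ L.entails Γ' φ

/-- Inclusion of consequence relations over the same set of formulas. -/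
instance {F : Type u} : LE (DeductiveSystem F) where
  le L L' := ∀ Γ φ, L.entails Γ φ → L'.entails Γ φ

/-- `f` is a conservative translation from `L₀` to `L₁`. -/
def IsConservativeTranslation {F₀ : Type u} {F₁ : Type v}
    (L₀ : DeductiveSystem F₀) (L₁ : DeductiveSystem F₁) (f : F₀ → F₁) : Prop :=
  ∀ Γ φ, L₀.entails Γ φ ↔ L₁.entails (f '' Γ) (f φ)

/-- `L₁` conservatively extends `L₀`: the formulas of `L₀` are (up to renaming, given by an
injection) among those of `L₁`, and on them the two consequence relations agree. -/
def ConservativelyExtends {F₁ : Type u} {F₀ : Type v}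
    (L₁ : DeductiveSystem F₁) (L₀ : DeductiveSystem F₀) : Prop :=
  ∃ e : F₀ ↪ F₁, IsConservativeTranslation L₀ L₁ e

/-- `L` is universal: every finitary deductive system over countably many formulas has a
conservative translation into `L`. -/
def IsUniversal {F : Type u} (L : DeductiveSystem F) : Prop :=
  ∀ (G : Type v) [Countable G] (M : DeductiveSystem G), M.Finitary →
    ∃ f : G → F, IsConservativeTranslation M L f

end DeductiveSystem

/-- The connectives of the full Lambek calculus. -/
inductive FLConnective where
  | and
  | or
  | fus
  | imp
  | coimp
  | one
  | zero

/-- Formulas of the full Lambek calculus, in the variables `var 0, var 1, …`.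
`fus φ ψ` is `φ · ψ`, `imp φ ψ` is `φ → ψ` and `coimp φ ψ` is `φ ← ψ`. -/
inductive FLFormula where
  | var (n : ℕ)
  | and (φ ψ : FLFormula)
  | or (φ ψ : FLFormula)
  | fus (φ ψ : FLFormula)
  | imp (φ ψ : FLFormula)
  | coimp (φ ψ : FLFormula)
  | one
  | zero

/-- A residuated lattice: `imp a c` is `a → c` and `coimp c b` is `c ← b`. -/
class ResiduatedLattice (A : Type u) extends Lattice A, Monoid A where
  imp : A → A → A
  coimp : A → A → A
  le_imp_iff : ∀ a b c : A, b ≤ imp a c ↔ a * b ≤ c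
  le_coimp_iff : ∀ a b c : A, a ≤ coimp c b ↔ a * b ≤ c

/-- An FL-algebra: a residuated lattice with a distinguished point `pt` (interpreting `0`). -/
class FLAlgebra (A : Type u) extends ResiduatedLattice A where
  pt : A

namespace FLFormula

/-- The formula is built from variables by connectives in `B` only. -/
def BuiltFrom (B : Set FLConnective) : FLFormula → Prop
  | var _ => True
  | and φ ψ => FLConnective.and ∈ B ∧ φ.BuiltFrom B ∧ ψ.BuiltFrom B
  | or φ ψ => FLConnective.or ∈ B ∧ φ.BuiltFrom B ∧ ψ.BuiltFrom B
  | fus φ ψ => FLConnective.fus ∈ B ∧ φ.BuiltFrom B ∧ ψ.BuiltFrom B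
  | imp φ ψ => FLConnective.imp ∈ B ∧ φ.BuiltFrom B ∧ ψ.BuiltFrom B
  | coimp φ ψ => FLConnective.coimp ∈ B ∧ φ.BuiltFrom B ∧ ψ.BuiltFrom B
  | one => FLConnective.one ∈ B
  | zero => FLConnective.zero ∈ B

/-- The value of a formula in an FL-algebra. -/
def eval {A : Type u} [FLAlgebra A] (w : ℕ → A) : FLFormula → A
  | var n => w n
  | and φ ψ => φ.eval w ⊓ ψ.eval w
  | or φ ψ => φ.eval w ⊔ ψ.eval w
  | fus φ ψ => φ.eval w * ψ.eval w
  | imp φ ψ => ResiduatedLattice.imp (φ.eval w) (ψ.eval w)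
  | coimp φ ψ => ResiduatedLattice.coimp (φ.eval w) (ψ.eval w)
  | one => 1
  | zero => FLAlgebra.pt

/-- The classical truth value of a formula: fusion is read as conjunction, `φ ← ψ` as the
converse implication, `1` as truth and `0` as falsity. -/
def boolEval (w : ℕ → Bool) : FLFormula → Bool
  | var n => w n
  | and φ ψ => φ.boolEval w && ψ.boolEval w
  | or φ ψ => φ.boolEval w || ψ.boolEval w
  | fus φ ψ => φ.boolEval w && ψ.boolEval w
  | imp φ ψ => !φ.boolEval w || ψ.boolEval w
  | coimp φ ψ => φ.boolEval w || !ψ.boolEval w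
  | one => true
  | zero => false

end FLFormula

/-- The logic of the matrices `(A, {x | 1 ≤ x})` with `A` an FL-algebra in the class `K`.
(As there are countably many formulas, algebras in `Type` suffice.) -/
def FLogic (K : ∀ (A : Type) [FLAlgebra A], Prop) : DeductiveSystem FLFormula where
  entails Γ φ := ∀ (A : Type) [FLAlgebra A], K A → ∀ w : ℕ → A,
    (∀ ψ ∈ Γ, 1 ≤ ψ.eval w) → 1 ≤ φ.eval w
  refl φ _ _ _ _ h := h φ rfl
  weaken _ _ _ h A _ hA w hw := h A hA w fun ψ hψ => hw ψ (Or.inl hψ)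
  cut _ _ _ h h' A _ hA w hw := h A hA w fun ψ hψ => h' ψ hψ A hA w hw

/-- The full Lambek calculus. -/
def FL : DeductiveSystem FLFormula := FLogic fun _ _ => True

/-- The full Lambek calculus with exchange: the logic of commutative FL-algebras. -/
def FLe : DeductiveSystem FLFormula := FLogic fun A _ => ∀ x y : A, x * y = y * x

/-- The full Lambek calculus with exchange and weakening: the logic of commutative integral
FL-algebras with least element `0`. -/
def FLew : DeductiveSystem FLFormula := FLogic fun A _ =>
  (∀ x y : A, x * y = y * x) ∧ ∀ x : A, FLAlgebra.pt ≤ x ∧ x ≤ 1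

/-- Classical propositional logic, over the functionally complete set of Boolean connectives
that interpret the connectives of the full Lambek calculus. -/
def CPC : DeductiveSystem FLFormula where
  entails Γ φ := ∀ w : ℕ → Bool, (∀ ψ ∈ Γ, ψ.boolEval w = true) → φ.boolEval w = true
  refl φ _ h := h φ rfl
  weaken _ _ _ h w hw := h w fun ψ hψ => hw ψ (Or.inl hψ)
  cut _ _ _ h h' w hw := h w fun ψ hψ => h' ψ hψ w hw

/-- The set of formulas of the fragment with connectives `B`. -/
abbrev FragmentFormula (B : Set FLConnective) : Type := {φ : FLFormula // φ.BuiltFrom B}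

/-- The fragment of `L` with connectives `B`. -/
def DeductiveSystem.fragment (L : DeductiveSystem FLFormula) (B : Set FLConnective) :
    DeductiveSystem (FragmentFormula B) where
  entails Γ φ := L.entails (Subtype.val '' Γ) φ.val
  refl φ := by
    rw [Set.image_singleton]
    exact L.refl φ.val
  weaken Γ Γ' φ h := by
    rw [Set.image_union]
    exact L.weaken _ _ _ h
  cut Γ Δ φ h h' := by
    refine L.cut _ _ _ h ?_
    rintro _ ⟨ψ, hψ, rfl⟩
    exact h' ψ hψ

/-- The logic BCK: the implicational fragment of `FLew`. -/
def BCK : DeductiveSystem (FragmentFormula {FLConnective.imp}) :=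
  FLew.fragment {FLConnective.imp}

/-!
A countable finitary system may be taken to live on `ℕ`. The translation `f n` of the formula `n` is
built by recursion from the translations of smaller numbers. Classically it is a conjunction of
* `atom n ∨ ⋁ₐ (⋀ f a)`, where `a` ranges over the finite sets of numbers below `n` that entail `n`;
* `⋀ f a → f j`, for `j < n` and finite sets `a` of numbers below `n` with `a ∪ {n} ⊢ j`.

The conjuncts of the second kind make the rules with largest formula `n` among the premises valid;
they are themselves consequences of any `f a` with `a ⊢ n`, by cut and induction. The conjunct of the
first kind is never used as a premise, so any formula will do that follows from each `f a` and is
classically equivalent to the disjunction. Given a theory `T`, let `atom n` be true exactly when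
`n ∈ T`; then so is `f n` (`TranslationOps.classical_translation`), and this gives conservativity
below `CPC`.

Without exchange and contraction, the sets `a` are replaced by words and conjunctions in premises by
products. What is proved (`TranslationOps.IsSound.pow_le_translation`) is that `∏ f w`, raised to a
power depending on a bound for the letters of `w`, lies below `f j` whenever the letters of `w`
entail `j`. This holds in integral residuated monoids in two situations:
* with a meet as the conjunction, where the power is `1`. The second kind of conjunct is then
  `a → (f j ← b)`, for all words `a`, `b`, because the letter `n` may occur anywhere in a word;
* under commutativity, with `(x₁ → ⋯ → (xₙ → r)) → r` as the conjunction. This acts as a product, up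
  to double negation relative to `r`, and forces the powers to grow.

The second situation settles `BCK`. To reach the first one without weakening, let
`t = (r → r) ∧ (s → s)`. The elements `y ≤ t` with `t y ≤ y` and `y t ≤ y` form an integral residuated
monoid with unit `t` (`ResiduatedLattice.LocalPart`), and for arbitrary `p` the element
`(s → (p → r)) ∧ t` is among them. With `r` read as falsity and `s` as truth, it is classically
the negation of `p`, which is all that is needed of `atom`.

The translation is defined from abstract operations (`TranslationOps`) and preserved by their
homomorphisms, so the same recursion is evaluated in formulas, in algebras, and classically.
-/

/-! ### Words and the rules of a deductive system on `ℕ` -/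

namespace DeductiveSystem

variable {G : Type v}

theorem entails_mono (M : DeductiveSystem G) {Γ Δ : Set G} (h : Γ ⊆ Δ) {φ : G}
    (hφ : M.entails Γ φ) : M.entails Δ φ := by
  simpa [Set.union_eq_self_of_subset_left h] using M.weaken Γ Δ φ hφ

theorem entails_of_mem (M : DeductiveSystem G) {Γ : Set G} {φ : G} (h : φ ∈ Γ) :
    M.entails Γ φ :=
  M.entails_mono (Set.singleton_subset_iff.2 h) (M.refl φ)

/-- The duplicate-free words over the letters `0, …, n - 1`. -/
def words (n : ℕ) : List (List ℕ) :=
  (List.range n).sublists.flatMap List.permutations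

theorem mem_words {n : ℕ} {v : List ℕ} : v ∈ words n ↔ v.Nodup ∧ ∀ i ∈ v, i < n := by
  simp only [words, List.mem_flatMap, List.mem_sublists, List.mem_permutations]
  constructor
  · rintro ⟨w, hw, hv⟩
    exact ⟨hv.nodup_iff.2 (hw.nodup List.nodup_range), fun i hi =>
      List.mem_range.1 (hw.subset (hv.subset hi))⟩
  · rintro ⟨hnd, hv⟩
    refine ⟨(List.range n).filter (· ∈ v), List.filter_sublist, ?_⟩
    rw [List.perm_ext_iff_of_nodup hnd (List.nodup_range.filter _)]
    intro i
    simp only [List.mem_filter, List.mem_range, decide_eq_true_eq]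
    exact ⟨fun hi => ⟨hv i hi, hi⟩, fun hi => hi.2⟩

open Classical in
/-- The words over `0, …, n - 1` whose letters entail `n`. -/
noncomputable def premises (M : DeductiveSystem ℕ) (n : ℕ) : List (List ℕ) :=
  (words n).filter fun v => M.entails {i | i ∈ v} n

open Classical in
/-- The triples `(a, b, j)` of words `a`, `b` over `0, …, n - 1` and a number `j < n` that is
entailed by `n` together with the letters of `a` and `b`. -/
noncomputable def consequences (M : DeductiveSystem ℕ) (n : ℕ) : List (List ℕ × List ℕ × ℕ) :=
  (words n ×ˢ words n ×ˢ List.range n).filter fun q =>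
    M.entails {i | i = n ∨ i ∈ q.1 ∨ i ∈ q.2.1} q.2.2

theorem mem_premises {M : DeductiveSystem ℕ} {n : ℕ} {v : List ℕ} :
    v ∈ M.premises n ↔ v ∈ words n ∧ M.entails {i | i ∈ v} n := by
  simp [premises]

theorem mem_consequences {M : DeductiveSystem ℕ} {n j : ℕ} {a b : List ℕ} :
    (a, b, j) ∈ M.consequences n ↔
      (a ∈ words n ∧ b ∈ words n ∧ j < n) ∧ M.entails {i | i = n ∨ i ∈ a ∨ i ∈ b} j := by
  simp [consequences]

end DeductiveSystem

open DeductiveSystem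

/-! ### The generic translation -/

/-- The operations from which the translation is built: the two implications (`imp a c` is
`a → c` and `coimp c b` is `c ← b`), a conjunction of lists, and for each `n` an element `atom n`
that is to be true exactly when `n` belongs to a given theory. -/
structure TranslationOps (X : Type u) where
  imp : X → X → X
  coimp : X → X → X
  conj : List X → X
  atom : ℕ → X

namespace TranslationOps

variable {X : Type u} {Y : Type v}

/-- `aₘ → (⋯ → (a₁ → x))` for `l = [a₁, …, aₘ]`, that is, `a₁ ⋯ aₘ → x`. -/
def impWord (S : TranslationOps X) (l : List X) (x : X) : X :=
  l.foldl (fun y a => S.imp a y) x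

/-- `((x ← aₘ) ← ⋯) ← a₁` for `l = [a₁, …, aₘ]`, that is, `x ← a₁ ⋯ aₘ`. -/
def coimpWord (S : TranslationOps X) (x : X) (l : List X) : X :=
  l.foldr (fun a y => S.coimp y a) x

/-- The letters of `v`, interpreted by `g`, written `k` times in succession. -/
def powWord (k : ℕ) (g : ℕ → X) (v : List ℕ) : List X :=
  (List.replicate k (v.map g)).flatten

/-- A substitute for the disjunction of `atom n` and the words that entail `n`. Each of these
words implies it, and classically it is equivalent to the disjunction. -/
noncomputable def intro (S : TranslationOps X) (M : DeductiveSystem ℕ) (k : ℕ) (g : ℕ → X)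
    (n : ℕ) : X :=
  S.impWord ((M.premises n).map fun v => S.coimpWord (S.atom n) (powWord k g v)) (S.atom n)

/-- The implication expressing that `n`, placed between the words `a` and `b`, yields `j`. -/
def elim (S : TranslationOps X) (k : ℕ) (g : ℕ → X) (q : List ℕ × List ℕ × ℕ) : X :=
  S.impWord (powWord k g q.1) (S.coimpWord (g q.2.2) (powWord k g q.2.1))

/-- The conjuncts of the translation of `n`, given the translations `g i` of all `i < n`. -/
noncomputable def conjuncts (S : TranslationOps X) (M : DeductiveSystem ℕ) (k : ℕ) (g : ℕ → X)
    (n : ℕ) : List X :=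
  S.intro M k g n :: (M.consequences n).map (S.elim k g)

/-- The translation of `n`, where words are raised to the power `k n`. -/
noncomputable def translation (S : TranslationOps X) (M : DeductiveSystem ℕ) (k : ℕ → ℕ)
    (n : ℕ) : X :=
  S.conj (S.conjuncts M (k n) (fun i => if i < n then translation S M k i else S.atom n) n)
termination_by n

theorem lt_of_mem_words {n : ℕ} {v : List ℕ} (h : v ∈ words n) : ∀ i ∈ v, i < n :=
  (mem_words.1 h).2

theorem powWord_congr {k n : ℕ} {g g' : ℕ → X} (h : ∀ i < n, g i = g' i) {v : List ℕ}
    (hv : v ∈ words n) : powWord k g v = powWord k g' v := by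
  unfold powWord
  rw [List.map_congr_left fun i hi => h i (lt_of_mem_words hv i hi)]

theorem conjuncts_congr (S : TranslationOps X) (M : DeductiveSystem ℕ) {k n : ℕ} {g g' : ℕ → X}
    (h : ∀ i < n, g i = g' i) : S.conjuncts M k g n = S.conjuncts M k g' n := by
  unfold conjuncts
  congr 1
  · unfold intro
    congr 1
    refine List.map_congr_left fun v hv => ?_
    rw [powWord_congr h (mem_premises.1 hv).1]
  · refine List.map_congr_left fun ⟨a, b, j⟩ hq => ?_
    obtain ⟨⟨ha, hb, hj⟩, -⟩ := mem_consequences.1 hq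
    simp only [elim, powWord_congr h ha, powWord_congr h hb, h j hj]

theorem translation_eq (S : TranslationOps X) (M : DeductiveSystem ℕ) (k : ℕ → ℕ) (n : ℕ) :
    S.translation M k n = S.conj (S.conjuncts M (k n) (S.translation M k) n) := by
  rw [translation]
  congr 1
  exact S.conjuncts_congr M fun i hi => if_pos hi

/-- `h` is a homomorphism for the operations that build the translation. -/
structure IsHom (S : TranslationOps X) (S' : TranslationOps Y) (h : X → Y) : Prop where
  imp : ∀ x y, h (S.imp x y) = S'.imp (h x) (h y)
  coimp : ∀ x y, h (S.coimp x y) = S'.coimp (h x) (h y)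
  conj : ∀ l, h (S.conj l) = S'.conj (l.map h)
  atom : ∀ n, h (S.atom n) = S'.atom n

namespace IsHom

variable {S : TranslationOps X} {S' : TranslationOps Y} {h : X → Y}

theorem impWord (H : S.IsHom S' h) (l : List X) (x : X) :
    h (S.impWord l x) = S'.impWord (l.map h) (h x) := by
  induction l generalizing x with
  | nil => rfl
  | cons a l ih =>
    have := ih (S.imp a x)
    rwa [H.imp] at this

theorem coimpWord (H : S.IsHom S' h) (l : List X) (x : X) :
    h (S.coimpWord x l) = S'.coimpWord (h x) (l.map h) := by
  induction l with
  | nil => rfl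
  | cons a l ih =>
    change h (S.coimp (S.coimpWord x l) a) = S'.coimp (S'.coimpWord (h x) (l.map h)) (h a)
    rw [H.coimp, ih]

theorem powWord (k : ℕ) (g : ℕ → X) (v : List ℕ) :
    (powWord k g v).map h = TranslationOps.powWord k (h ∘ g) v := by
  simp [TranslationOps.powWord, List.map_flatten]

theorem conjuncts (H : S.IsHom S' h) (M : DeductiveSystem ℕ) (k : ℕ) (g : ℕ → X) (n : ℕ) :
    (S.conjuncts M k g n).map h = S'.conjuncts M k (h ∘ g) n := by
  simp [TranslationOps.conjuncts, intro, elim, H.impWord, H.coimpWord, powWord, H.atom,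
    Function.comp_def]

theorem translation (H : S.IsHom S' h) (M : DeductiveSystem ℕ) (k : ℕ → ℕ) (n : ℕ) :
    h (S.translation M k n) = S'.translation M k n := by
  induction n using Nat.strong_induction_on with
  | _ n ih =>
    rw [translation_eq, translation_eq, H.conj, H.conjuncts,
      S'.conjuncts_congr M (g := h ∘ S.translation M k) ih]

end IsHom

/-! ### Classical evaluation of the translation -/

/-- The classical interpretation of the operations, with `atom n` true when `n ∈ T`. -/
def classical (T : Set ℕ) : TranslationOps Prop where
  imp p q := p → q
  coimp q p := p → q
  conj l := ∀ p ∈ l, p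
  atom n := n ∈ T

theorem classical_impWord (T : Set ℕ) (l : List Prop) (p : Prop) :
    (classical T).impWord l p ↔ ((∀ q ∈ l, q) → p) := by
  induction l generalizing p with
  | nil => simp [impWord]
  | cons a l ih =>
    change (classical T).impWord l (a → p) ↔ _
    rw [ih]
    simp only [List.forall_mem_cons, and_imp]
    tauto

theorem classical_coimpWord (T : Set ℕ) (l : List Prop) (p : Prop) :
    (classical T).coimpWord p l ↔ ((∀ q ∈ l, q) → p) := by
  induction l with
  | nil => simp [coimpWord]
  | cons a l ih =>
    change (a → (classical T).coimpWord p l) ↔ _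
    rw [ih]
    simp only [List.forall_mem_cons, and_imp]

theorem forall_mem_powWord {k : ℕ} (hk : 1 ≤ k) (g : ℕ → Prop) (v : List ℕ) :
    (∀ q ∈ powWord k g v, q) ↔ ∀ i ∈ v, g i := by
  have : k ≠ 0 := by omega
  simp only [powWord, List.mem_flatten, List.mem_replicate]
  constructor
  · exact fun h i hi => h _ ⟨_, ⟨this, rfl⟩, List.mem_map_of_mem hi⟩
  · rintro h q ⟨_, ⟨-, rfl⟩, hq⟩
    obtain ⟨i, hi, rfl⟩ := List.mem_map.1 hq
    exact h i hi

/-- If `T` is a theory, then classically the translation of `n` says that `n ∈ T`. -/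
theorem classical_translation {M : DeductiveSystem ℕ} {T : Set ℕ}
    (hT : ∀ n, M.entails T n → n ∈ T) {k : ℕ → ℕ} (hk : ∀ n, 1 ≤ k n) (n : ℕ) :
    (classical T).translation M k n ↔ n ∈ T := by
  induction n using Nat.strong_induction_on with
  | _ n ih =>
    rw [translation_eq]
    change (∀ p ∈ conjuncts _ _ _ _ _, p) ↔ _
    simp only [conjuncts, List.forall_mem_cons, List.forall_mem_map, intro, elim,
      classical_impWord, classical_coimpWord, forall_mem_powWord (hk n)]
    change (_ → n ∈ T) ∧ _ ↔ _
    constructor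
    · -- If `n ∉ T`, no word that entails `n` has all its letters in `T`.
      rintro ⟨h, -⟩
      refine h fun v hv hvT => hT n (M.entails_mono ?_ (mem_premises.1 hv).2)
      exact fun i hi => (ih i (lt_of_mem_words (mem_premises.1 hv).1 i hi)).1 (hvT i hi)
    · refine fun hn => ⟨fun _ => hn, ?_⟩
      rintro ⟨a, b, j⟩ hq ha hb
      obtain ⟨⟨ha', hb', hj⟩, hM⟩ := mem_consequences.1 hq
      refine (ih j hj).2 (hT j (M.entails_mono ?_ hM))
      rintro i (rfl | hi | hi)
      · exact hn
      · exact (ih i (lt_of_mem_words ha' i hi)).1 (ha i hi)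
      · exact (ih i (lt_of_mem_words hb' i hi)).1 (hb i hi)

/-! ### Soundness of the translation in integral residuated monoids -/

/-- An interpretation of the operations in an integral residuated monoid for which the translation
is sound. The conjunction of a list need only lie below those members that are `Good`. It may be
a product rather than a meet: a common lower bound of the members then has to be raised to a
power, which is why the exponent of words may change from `k n` to `k (n + 1)`. -/
structure IsSound [Monoid X] [PartialOrder X] (S : TranslationOps X) (M : DeductiveSystem ℕ)
    (k : ℕ → ℕ) (Good : X → Prop) : Prop where
  le_imp_iff : ∀ a b c, b ≤ S.imp a c ↔ a * b ≤ c
  le_coimp_iff : ∀ a b c, a ≤ S.coimp c b ↔ a * b ≤ c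
  le_one : ∀ a : X, a ≤ 1
  good_imp : ∀ a c, Good c → Good (S.imp a c)
  good_coimp : ∀ c b, Good c → Good (S.coimp c b)
  good_conj : ∀ l, Good (S.conj l)
  good_atom : ∀ n, Good (S.atom n)
  conj_le : ∀ l x, x ∈ l → Good x → S.conj l ≤ x
  le_conj : ∀ n l a, l.length = (M.consequences n).length + 1 →
    (∀ x ∈ l, a ^ k n ≤ x) → a ^ k (n + 1) ≤ S.conj l
  mul_pow : ∀ n (a b : X), (a * b) ^ k n = a ^ k n * b ^ k n
  one_le : ∀ n, 1 ≤ k n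
  le_succ : ∀ n, k n ≤ k (n + 1)

theorem prod_powWord [Monoid X] (m : ℕ) (g : ℕ → X) (v : List ℕ) :
    (powWord m g v).prod = (v.map g).prod ^ m := by
  simp [powWord, List.prod_flatten]

namespace IsSound

variable [Monoid X] [PartialOrder X] {S : TranslationOps X} {M : DeductiveSystem ℕ} {k : ℕ → ℕ}
  {Good : X → Prop}

theorem mulLeftMono (H : S.IsSound M k Good) : MulLeftMono X where
  elim a b c h := (H.le_imp_iff a b _).1 (h.trans ((H.le_imp_iff a c _).2 le_rfl))

theorem mulRightMono (H : S.IsSound M k Good) : MulRightMono X where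
  elim a b c h := (H.le_coimp_iff b a _).1 (h.trans ((H.le_coimp_iff c a _).2 le_rfl))

theorem le_impWord_iff (H : S.IsSound M k Good) (l : List X) (b c : X) :
    b ≤ S.impWord l c ↔ l.prod * b ≤ c := by
  induction l generalizing c with
  | nil => simp [impWord]
  | cons a l ih =>
    change b ≤ S.impWord l (S.imp a c) ↔ _
    rw [ih, H.le_imp_iff, List.prod_cons, mul_assoc]

theorem le_coimpWord_iff (H : S.IsSound M k Good) (l : List X) (b c : X) :
    b ≤ S.coimpWord c l ↔ b * l.prod ≤ c := by
  induction l generalizing b with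
  | nil => simp [coimpWord]
  | cons a l ih =>
    change b ≤ S.coimp (S.coimpWord c l) a ↔ _
    rw [H.le_coimp_iff, ih, List.prod_cons, mul_assoc]

theorem good_impWord (H : S.IsSound M k Good) (l : List X) {c : X} (hc : Good c) :
    Good (S.impWord l c) := by
  induction l generalizing c with
  | nil => exact hc
  | cons a l ih => exact ih (H.good_imp a c hc)

theorem good_coimpWord (H : S.IsSound M k Good) (l : List X) {c : X} (hc : Good c) :
    Good (S.coimpWord c l) := by
  induction l with
  | nil => exact hc
  | cons a l ih => exact H.good_coimp _ _ ih

theorem good_translation (H : S.IsSound M k Good) (n : ℕ) : Good (S.translation M k n) := by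
  rw [translation_eq]
  exact H.good_conj _

/-- Weakening: by integrality, letters may be inserted into a word. -/
theorem prod_le_of_sublist (H : S.IsSound M k Good) {l l' : List X} (h : l'.Sublist l) :
    l.prod ≤ l'.prod := by
  have := H.mulLeftMono
  have := H.mulRightMono
  induction h with
  | slnil => exact le_rfl
  | cons a _ ih =>
    rw [List.prod_cons]
    exact mul_le_of_le_one_of_le (H.le_one a) ih
  | cons_cons a _ ih =>
    rw [List.prod_cons, List.prod_cons]
    exact mul_le_mul_right ih a

theorem pow_le_pow (H : S.IsSound M k Good) (a : X) {m n : ℕ} (h : m ≤ n) : a ^ n ≤ a ^ m := by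
  have := H.mulLeftMono
  exact pow_le_pow_right_of_le_one' (H.le_one a) h

theorem translation_le_elim (H : S.IsSound M k Good) {n j : ℕ} {a b : List ℕ}
    (h : (a, b, j) ∈ M.consequences n) :
    (a.map (S.translation M k)).prod ^ k n * S.translation M k n *
      (b.map (S.translation M k)).prod ^ k n ≤ S.translation M k j := by
  have hle : S.translation M k n ≤ S.elim (k n) (S.translation M k) (a, b, j) := by
    conv_lhs => rw [translation_eq]
    refine H.conj_le _ _ (List.mem_cons_of_mem _ (List.mem_map_of_mem h)) ?_
    exact H.good_impWord _ (H.good_coimpWord _ (H.good_translation j))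
  rwa [elim, H.le_impWord_iff, H.le_coimpWord_iff, prod_powWord, prod_powWord] at hle

/-- Of the antecedents of `intro`, only the one belonging to `v` is needed; integrality discards the
others. -/
theorem pow_le_intro (H : S.IsSound M k Good) {n : ℕ} {v : List ℕ} (hv : v ∈ M.premises n)
    (g : ℕ → X) : (v.map g).prod ^ k n ≤ S.intro M (k n) g n := by
  have := H.mulRightMono
  rw [intro, H.le_impWord_iff]
  set y := S.coimpWord (S.atom n) (powWord (k n) g v) with hy
  have hyv : y * (v.map g).prod ^ k n ≤ S.atom n := by
    rw [← prod_powWord, ← H.le_coimpWord_iff]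
  refine le_trans (mul_le_mul_left ?_ _) hyv
  refine (H.prod_le_of_sublist (l' := [y]) ?_).trans_eq (List.prod_singleton)
  exact List.singleton_sublist.2 (List.mem_map.2 ⟨v, hv, rfl⟩)

/-- If the letters of a word entail `j`, a power of the word lies below the translation of `j`. -/
theorem pow_le_translation (H : S.IsSound M k Good) (n : ℕ) :
    ∀ (w : List ℕ) (j : ℕ), (∀ i ∈ w, i < n) → j < n → M.entails {i | i ∈ w} j →
      (w.map (S.translation M k)).prod ^ k n ≤ S.translation M k j := by
  have := H.mulLeftMono
  have := H.mulRightMono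
  set f := S.translation M k with hf
  induction n with
  | zero => intro w j _ hj; omega
  | succ n ih =>
    intro w j hw hj hM
    -- A shorter word has a larger product and, having fewer letters, is covered by `ih`.
    have key : ∀ w' : List ℕ, w'.Sublist w → (w.map f).prod ≤ (w'.map f).prod :=
      fun w' h => H.prod_le_of_sublist (h.map f)
    -- The letters below `n` of a word, each written once.
    have red : ∀ v : List ℕ, ∃ v' ∈ words n, v'.Sublist v ∧ ∀ i ∈ v, i < n → i ∈ v' := by
      intro v
      refine ⟨(v.filter (· < n)).dedup, mem_words.2 ⟨List.nodup_dedup _, ?_⟩,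
        (List.dedup_sublist _).trans List.filter_sublist, ?_⟩
      · intro i hi
        simpa using (List.mem_filter.1 (List.mem_dedup.1 hi)).2
      · intro i hi hin
        exact List.mem_dedup.2 (List.mem_filter.2 ⟨hi, by simpa using hin⟩)
    by_cases hnw : n ∈ w
    · rcases Nat.lt_succ_iff_lt_or_eq.1 hj with hj | rfl
      · obtain ⟨w₁, w₂, rfl⟩ := List.append_of_mem hnw
        obtain ⟨a, ha, has, hal⟩ := red w₁
        obtain ⟨b, hb, hbs, hbl⟩ := red w₂
        have hq : (a, b, j) ∈ M.consequences n := by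
          refine mem_consequences.2 ⟨⟨ha, hb, hj⟩, M.entails_mono ?_ hM⟩
          intro i hi
          have hin := hw i hi
          have hi' : i ∈ w₁ ∨ i = n ∨ i ∈ w₂ := by simpa using hi
          change i = n ∨ i ∈ a ∨ i ∈ b
          rcases Nat.lt_succ_iff_lt_or_eq.1 hin with hin | hin
          · rcases hi' with h | h | h
            · exact Or.inr (Or.inl (hal i h hin))
            · exact Or.inl h
            · exact Or.inr (Or.inr (hbl i h hin))
          · exact Or.inl hin
        refine le_trans ?_ (H.translation_le_elim hq)
        calc ((w₁ ++ n :: w₂).map f).prod ^ k (n + 1)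
            ≤ ((a ++ n :: b).map f).prod ^ k (n + 1) :=
              pow_le_pow_left' (key _ (has.append (hbs.cons_cons n))) _
          _ ≤ ((a ++ n :: b).map f).prod ^ k n := H.pow_le_pow _ (H.le_succ n)
          _ = (a.map f).prod ^ k n * f n ^ k n * (b.map f).prod ^ k n := by
              rw [List.map_append, List.map_cons, List.prod_append, List.prod_cons, H.mul_pow,
                H.mul_pow, mul_assoc]
          _ ≤ (a.map f).prod ^ k n * f n * (b.map f).prod ^ k n := by
              refine mul_le_mul_left (mul_le_mul_right ?_ _) _
              simpa using H.pow_le_pow (f n) (H.one_le n)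
      · calc (w.map f).prod ^ k (j + 1)
            ≤ (w.map f).prod ^ 1 := H.pow_le_pow _ (H.one_le _)
          _ = (w.map f).prod := pow_one _
          _ ≤ ([j].map f).prod := key _ (List.singleton_sublist.2 hnw)
          _ = f j := by simp
    · have hwn : ∀ i ∈ w, i < n := fun i hi =>
        lt_of_le_of_ne (Nat.lt_succ_iff.1 (hw i hi)) fun h => hnw (h ▸ hi)
      rcases Nat.lt_succ_iff_lt_or_eq.1 hj with hj | rfl
      · exact (H.pow_le_pow _ (H.le_succ n)).trans (ih w j hwn hj hM)
      · obtain ⟨v, hv, hvs, hvl⟩ := red w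
        have hvM : v ∈ M.premises j :=
          mem_premises.2 ⟨hv, M.entails_mono (fun i hi => hvl i hi (hwn i hi)) hM⟩
        rw [hf, translation_eq, ← hf]
        refine H.le_conj j _ _ (by simp [conjuncts]) ?_
        simp only [conjuncts, List.forall_mem_cons, List.forall_mem_map]
        refine ⟨(pow_le_pow_left' (key v hvs) _).trans (H.pow_le_intro hvM f), ?_⟩
        rintro ⟨a, b, i⟩ hq
        obtain ⟨⟨ha, hb, hi⟩, hMi⟩ := mem_consequences.1 hq
        rw [elim, H.le_impWord_iff, H.le_coimpWord_iff, prod_powWord, prod_powWord, ← H.mul_pow,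
          ← H.mul_pow, ← List.prod_append, ← List.prod_append, ← List.map_append,
          ← List.map_append]
        refine ih (a ++ w ++ b) i ?_ hi ?_
        · intro l hl
          simp only [List.mem_append] at hl
          rcases hl with (hl | hl) | hl
          · exact lt_of_mem_words ha l hl
          · exact hwn l hl
          · exact lt_of_mem_words hb l hl
        -- `w` entails `j`, which together with `a` and `b` entails `i`.
        · refine M.cut _ _ _ hMi ?_
          rintro l (rfl | hl | hl)
          · exact M.entails_mono (fun m hm => by
              have hm : m ∈ w := hm
              simp [hm]) hM
          · exact M.entails_of_mem (by simp [hl])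
          · exact M.entails_of_mem (by simp [hl])

theorem one_le_translation (H : S.IsSound M k Good) {Γ : Set ℕ} (hΓ : Γ.Finite) {n : ℕ}
    (hM : M.entails Γ n) (h : ∀ i ∈ Γ, 1 ≤ S.translation M k i) : 1 ≤ S.translation M k n := by
  have := H.mulLeftMono
  have := H.mulRightMono
  have hmem : ∀ i, i ∈ hΓ.toFinset.toList ↔ i ∈ Γ := by simp
  obtain ⟨N, hN⟩ := (hΓ.insert n).bddAbove
  refine le_trans ?_ (H.pow_le_translation (N + 1) hΓ.toFinset.toList n
    (fun i hi => Nat.lt_succ_of_le (hN (Or.inr ((hmem i).1 hi))))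
    (Nat.lt_succ_of_le (hN (Or.inl rfl))) (by simpa [hmem] using hM))
  refine one_le_pow_of_one_le' (List.one_le_prod_of_one_le ?_) _
  intro x hx
  obtain ⟨i, hi, rfl⟩ := List.mem_map.1 hx
  exact h i ((hmem i).1 hi)

end IsSound

end TranslationOps

/-! ### The integral residuated monoid below a local unit -/

namespace ResiduatedLattice

variable {A : Type u} [ResiduatedLattice A]

instance : MulLeftMono A where
  elim a b c h := (le_imp_iff a b _).1 (h.trans ((le_imp_iff a c _).2 le_rfl))

instance : MulRightMono A where
  elim a b c h := (le_coimp_iff b a _).1 (h.trans ((le_coimp_iff c a _).2 le_rfl))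

theorem mul_imp_le (a c : A) : a * imp a c ≤ c := (le_imp_iff _ _ _).1 le_rfl

theorem coimp_mul_le (c b : A) : coimp c b * b ≤ c := (le_coimp_iff _ _ _).1 le_rfl

/-- The greatest element that does not increase `r` and `s` when they are multiplied by it on the
right. It serves as a definable substitute for `1`. -/
def localUnit (r s : A) : A := imp r r ⊓ imp s s

theorem le_localUnit_iff {r s a : A} : a ≤ localUnit r s ↔ r * a ≤ r ∧ s * a ≤ s := by
  rw [localUnit, le_inf_iff, le_imp_iff, le_imp_iff]

theorem one_le_localUnit (r s : A) : 1 ≤ localUnit r s := by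
  simp [le_localUnit_iff]

theorem left_mul_localUnit_le (r s : A) : r * localUnit r s ≤ r :=
  (le_localUnit_iff.1 le_rfl).1

theorem right_mul_localUnit_le (r s : A) : s * localUnit r s ≤ s :=
  (le_localUnit_iff.1 le_rfl).2

theorem localUnit_mul_self (r s : A) : localUnit r s * localUnit r s ≤ localUnit r s := by
  refine le_localUnit_iff.2 ⟨?_, ?_⟩
  · rw [← mul_assoc]
    exact (mul_le_mul_left (left_mul_localUnit_le r s) _).trans (left_mul_localUnit_le r s)
  · rw [← mul_assoc]
    exact (mul_le_mul_left (right_mul_localUnit_le r s) _).trans (right_mul_localUnit_le r s)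

/-- `y` lies below `localUnit r s`, which acts on it as a unit. -/
def IsLocal (r s y : A) : Prop :=
  y ≤ localUnit r s ∧ localUnit r s * y ≤ y ∧ y * localUnit r s ≤ y

variable {r s x y : A}

theorem isLocal_localUnit (r s : A) : IsLocal r s (localUnit r s) :=
  ⟨le_rfl, localUnit_mul_self r s, localUnit_mul_self r s⟩

theorem IsLocal.mul (hx : IsLocal r s x) (hy : IsLocal r s y) : IsLocal r s (x * y) := by
  refine ⟨(mul_le_mul' hx.1 hy.1).trans (localUnit_mul_self r s), ?_, ?_⟩
  · rw [← mul_assoc]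
    exact mul_le_mul_left hx.2.1 _
  · rw [mul_assoc]
    exact mul_le_mul_right hy.2.2 _

theorem IsLocal.inf (hx : IsLocal r s x) (hy : IsLocal r s y) : IsLocal r s (x ⊓ y) := by
  refine ⟨inf_le_left.trans hx.1, le_inf ?_ ?_, le_inf ?_ ?_⟩
  · exact (mul_le_mul_right inf_le_left _).trans hx.2.1
  · exact (mul_le_mul_right inf_le_right _).trans hy.2.1
  · exact (mul_le_mul_left inf_le_left _).trans hx.2.2
  · exact (mul_le_mul_left inf_le_right _).trans hy.2.2

theorem isLocal_inf_localUnit (h₁ : localUnit r s * x ≤ x) (h₂ : x * localUnit r s ≤ x) :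
    IsLocal r s (x ⊓ localUnit r s) := by
  refine ⟨inf_le_right, le_inf ?_ ?_, le_inf ?_ ?_⟩
  · exact (mul_le_mul_right inf_le_left _).trans h₁
  · exact (mul_le_mul_right inf_le_right _).trans (localUnit_mul_self r s)
  · exact (mul_le_mul_left inf_le_left _).trans h₂
  · exact (mul_le_mul_left inf_le_right _).trans (localUnit_mul_self r s)

theorem IsLocal.imp (hx : IsLocal r s x) (hy : IsLocal r s y) :
    IsLocal r s (imp x y ⊓ localUnit r s) := by
  refine isLocal_inf_localUnit ((le_imp_iff _ _ _).2 ?_) ((le_imp_iff _ _ _).2 ?_)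
  · rw [← mul_assoc]
    exact (mul_le_mul_left hx.2.2 _).trans (mul_imp_le x y)
  · rw [← mul_assoc]
    exact (mul_le_mul_left (mul_imp_le x y) _).trans hy.2.2

theorem IsLocal.coimp (hx : IsLocal r s x) (hy : IsLocal r s y) :
    IsLocal r s (coimp y x ⊓ localUnit r s) := by
  refine isLocal_inf_localUnit ((le_coimp_iff _ _ _).2 ?_) ((le_coimp_iff _ _ _).2 ?_)
  · rw [mul_assoc]
    exact (mul_le_mul_right (coimp_mul_le y x) _).trans hy.2.1
  · rw [mul_assoc]
    exact (mul_le_mul_right hx.2.1 _).trans (coimp_mul_le y x)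

/-- Multiplied on the left of `s → (p → r)`, the local unit is absorbed by the antecedent `s`, and
multiplied on the right, by the conclusion `r`. Hence `p` may be arbitrary. -/
theorem isLocal_atom (r s p : A) :
    IsLocal r s (ResiduatedLattice.imp s (ResiduatedLattice.imp p r) ⊓ localUnit r s) := by
  have h := mul_imp_le p r
  have h' := mul_imp_le s (ResiduatedLattice.imp p r)
  refine isLocal_inf_localUnit ?_ ?_
  · rw [le_imp_iff, ← mul_assoc]
    exact (mul_le_mul_left (right_mul_localUnit_le r s) _).trans h'
  · rw [le_imp_iff, ← mul_assoc, le_imp_iff, ← mul_assoc]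
    refine (mul_le_mul_left ((mul_le_mul_right h' p).trans h) _).trans (left_mul_localUnit_le r s)

/-- The elements on which `localUnit r s` acts as a greatest element and as a unit. -/
def LocalPart (r s : A) : Type u := {y : A // IsLocal r s y}

instance (r s : A) : PartialOrder (LocalPart r s) :=
  inferInstanceAs (PartialOrder {y : A // IsLocal r s y})

instance (r s : A) : Monoid (LocalPart r s) where
  mul x y := ⟨x.1 * y.1, x.2.mul y.2⟩
  one := ⟨localUnit r s, isLocal_localUnit r s⟩
  mul_assoc x y z := Subtype.ext (mul_assoc x.1 y.1 z.1)
  one_mul x := Subtype.ext (le_antisymm x.2.2.1 (le_mul_of_one_le_left' (one_le_localUnit r s)))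
  mul_one x := Subtype.ext (le_antisymm x.2.2.2 (le_mul_of_one_le_right' (one_le_localUnit r s)))

theorem LocalPart.one_le_iff {x : LocalPart r s} : 1 ≤ x ↔ 1 ≤ x.1 := by
  constructor
  · exact fun h => (one_le_localUnit r s).trans h
  · intro h
    exact (le_mul_of_one_le_right' h).trans x.2.2.1

/-- The operations of the translation relative to the local unit. -/
def localOps (r s : A) (p : ℕ → A) : TranslationOps A where
  imp x y := imp x y ⊓ localUnit r s
  coimp y x := coimp y x ⊓ localUnit r s
  conj l := l.foldr (· ⊓ ·) (localUnit r s)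
  atom n := imp s (imp (p n) r) ⊓ localUnit r s

/-- The restriction of `localOps` to the elements below the local unit. -/
def localPartOps (r s : A) (p : ℕ → A) : TranslationOps (LocalPart r s) where
  imp x y := ⟨_, x.2.imp y.2⟩
  coimp y x := ⟨_, x.2.coimp y.2⟩
  conj l := l.foldr (fun x y => ⟨_, x.2.inf y.2⟩) 1
  atom n := ⟨_, isLocal_atom r s (p n)⟩

theorem isHom_val_localPartOps (r s : A) (p : ℕ → A) :
    (localPartOps r s p).IsHom (localOps r s p) Subtype.val where
  imp _ _ := rfl
  coimp _ _ := rfl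
  conj l := by
    induction l with
    | nil => rfl
    | cons a l ih => exact congrArg (a.1 ⊓ ·) ih
  atom _ := rfl

/-- Since the conjunction is a meet here, words need not be raised to higher powers. -/
theorem isSound_localPartOps (r s : A) (p : ℕ → A) (M : DeductiveSystem ℕ) :
    (localPartOps r s p).IsSound M (fun _ => 1) (fun _ => True) where
  le_imp_iff a b c := by
    change b.1 ≤ imp a.1 c.1 ⊓ localUnit r s ↔ a.1 * b.1 ≤ c.1
    rw [le_inf_iff, and_iff_left b.2.1, le_imp_iff]
  le_coimp_iff a b c := by
    change a.1 ≤ coimp c.1 b.1 ⊓ localUnit r s ↔ a.1 * b.1 ≤ c.1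
    rw [le_inf_iff, and_iff_left a.2.1, le_coimp_iff]
  le_one a := a.2.1
  good_imp _ _ _ := trivial
  good_coimp _ _ _ := trivial
  good_conj _ := trivial
  good_atom _ := trivial
  conj_le l x hx _ := by
    induction l with
    | nil => simp at hx
    | cons a l ih =>
      rcases List.mem_cons.1 hx with rfl | hx
      · exact (inf_le_left : x.1 ⊓ _ ≤ x.1)
      · exact le_trans (inf_le_right : a.1 ⊓ _ ≤ _) (ih hx)
  le_conj _ l a hl h := by
    clear hl
    simp only [pow_one] at h ⊢
    induction l with
    | nil => exact a.2.1
    | cons b l ih =>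
      rw [List.forall_mem_cons] at h
      exact (le_inf (h.1 : a.1 ≤ b.1) (ih h.2) : a.1 ≤ b.1 ⊓ _)
  mul_pow _ a b := by simp
  one_le _ := le_rfl
  le_succ _ := le_rfl

end ResiduatedLattice

/-! ### Implication alone, in commutative integral residuated monoids -/

/-- The operations of the translation in terms of implication, with the conjunction
`(x₁ → (⋯ → (xₙ → r))) → r`. -/
def TranslationOps.ofImp {X : Type u} (imp : X → X → X) (r : X) (p : ℕ → X) :
    TranslationOps X where
  imp := imp
  coimp y x := imp x y
  conj l := imp (l.foldr imp r) r
  atom n := imp (p n) r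

/-- Exponents for `TranslationOps.ofImp`, where the conjunction acts as a product: each step
multiplies them by the number of conjuncts. -/
noncomputable def DeductiveSystem.exponent (M : DeductiveSystem ℕ) : ℕ → ℕ
  | 0 => 1
  | n + 1 => M.exponent n * ((M.consequences n).length + 1)

theorem DeductiveSystem.one_le_exponent (M : DeductiveSystem ℕ) (n : ℕ) : 1 ≤ M.exponent n := by
  induction n with
  | zero => exact le_rfl
  | succ n ih => exact Nat.mul_pos ih (Nat.succ_pos _)

/-- Here the good elements are those that are equivalent to their double negation relative
to `r`. -/
theorem TranslationOps.isSound_ofImp {X : Type u} [CommMonoid X] [PartialOrder X]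
    {imp : X → X → X} (himp : ∀ a b c, b ≤ imp a c ↔ a * b ≤ c) (hone : ∀ a : X, a ≤ 1)
    (r : X) (p : ℕ → X) (M : DeductiveSystem ℕ) :
    (ofImp imp r p).IsSound M M.exponent (fun x => imp (imp x r) r ≤ x) := by
  have mono : MulLeftMono X :=
    ⟨fun a b c h => (himp a b _).1 (h.trans ((himp a c _).2 le_rfl))⟩
  have mono' : MulRightMono X := by
    refine ⟨fun a b c h => ?_⟩
    change b * a ≤ c * a
    rw [mul_comm b, mul_comm c]
    exact mul_le_mul_right h a
  have mp : ∀ a c, a * imp a c ≤ c := fun a c => (himp a _ c).1 le_rfl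
  have good : ∀ a c, imp (imp c r) r ≤ c → imp (imp (imp a c) r) r ≤ imp a c := by
    intro a c hc
    rw [himp]
    refine le_trans ?_ hc
    rw [himp, ← mul_assoc]
    -- From `a` and `c → r` one obtains `(a → c) → r`.
    refine le_trans (mul_le_mul_left ((himp _ _ r).2 ?_) _) (mp (imp (imp a c) r) r)
    calc imp a c * (imp c r * a) = a * imp a c * imp c r := by ac_rfl
      _ ≤ c * imp c r := mul_le_mul_left (mp a c) _
      _ ≤ r := mp c r
  have weak : ∀ a c, c ≤ imp a c := fun a c => (himp _ _ _).2 (mul_le_of_le_one_left' (hone a))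
  have good_r : imp (imp r r) r ≤ r := by
    have h : (1 : X) ≤ imp r r := (himp _ _ _).2 (mul_one r).le
    calc imp (imp r r) r ≤ imp r r * imp (imp r r) r := le_mul_of_one_le_left' h
      _ ≤ r := mp _ r
  exact
  { le_imp_iff := himp
    le_coimp_iff := fun a b c => by rw [mul_comm]; exact himp b a c
    le_one := hone
    good_imp := good
    good_coimp := fun c b => good b c
    good_conj := fun l => good _ r good_r
    good_atom := fun n => good _ r good_r
    conj_le := by
      intro l x hx hgood
      have hr : ∀ l : List X, r ≤ l.foldr imp r := by
        intro l
        induction l with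
        | nil => exact le_rfl
        | cons a l ih => exact ih.trans (weak _ _)
      have hneg : imp x r ≤ l.foldr imp r := by
        induction l with
        | nil => simp at hx
        | cons a l ih =>
          rcases List.mem_cons.1 hx with rfl | hx
          · exact (himp _ _ _).2 ((mp x r).trans (hr l))
          · exact (ih hx).trans (weak _ _)
      refine le_trans ((himp _ _ r).2 ?_) hgood
      exact (mul_le_mul_left hneg _).trans (mp _ r)
    le_conj := by
      intro n l a hl h
      have key : ∀ (l : List X) (b : X), (∀ x ∈ l, b ≤ x) → l.foldr imp r * b ^ l.length ≤ r := by
        intro l b h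
        induction l with
        | nil => simp
        | cons x l ih =>
          rw [List.forall_mem_cons] at h
          calc imp x (l.foldr imp r) * b ^ (l.length + 1)
              = b * imp x (l.foldr imp r) * b ^ l.length := by rw [pow_succ]; ac_rfl
            _ ≤ x * imp x (l.foldr imp r) * b ^ l.length :=
                mul_le_mul_left (mul_le_mul_left h.1 _) _
            _ ≤ l.foldr imp r * b ^ l.length := mul_le_mul_left (mp _ _) _
            _ ≤ r := ih h.2
      refine (himp _ _ r).2 ?_
      have := key l _ h
      rwa [← pow_mul, hl] at this
    mul_pow := fun n a b => mul_pow a b _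
    one_le := M.one_le_exponent
    le_succ := fun n => Nat.le_mul_of_pos_right _ (Nat.succ_pos _) }

/-! ### The operations on formulas -/

namespace FLFormula

variable {B : Set FLConnective}

/-- A variable, as a formula of the fragment. -/
def fragVar (B : Set FLConnective) (n : ℕ) : FragmentFormula B := ⟨var n, trivial⟩

/-- Implication in a fragment that contains it. -/
def fragImp (hi : .imp ∈ B) (φ ψ : FragmentFormula B) : FragmentFormula B :=
  ⟨imp φ.1 ψ.1, hi, φ.2, ψ.2⟩

/-- Conjunction in a fragment that contains it. -/
def fragAnd (ha : .and ∈ B) (φ ψ : FragmentFormula B) : FragmentFormula B :=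
  ⟨and φ.1 ψ.1, ha, φ.2, ψ.2⟩

/-- The formula defining `ResiduatedLattice.localUnit` for the values of the variables `0`
and `1`. -/
def fragUnit (hi : .imp ∈ B) (ha : .and ∈ B) : FragmentFormula B :=
  fragAnd ha (fragImp hi (fragVar B 0) (fragVar B 0)) (fragImp hi (fragVar B 1) (fragVar B 1))

/-- The operations of the translation in a fragment with implication and conjunction. The
backward implication is a parameter, as it need not be a connective of the fragment. Variable `0`
stands for falsity, variable `1` for truth, and variable `n + 2` for the negation of `n`. -/
def andOps (hi : .imp ∈ B) (ha : .and ∈ B)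
    (coimp : FragmentFormula B → FragmentFormula B → FragmentFormula B) :
    TranslationOps (FragmentFormula B) where
  imp φ ψ := fragAnd ha (fragImp hi φ ψ) (fragUnit hi ha)
  coimp ψ φ := fragAnd ha (coimp ψ φ) (fragUnit hi ha)
  conj l := l.foldr (fragAnd ha) (fragUnit hi ha)
  atom n := fragAnd ha
    (fragImp hi (fragVar B 1) (fragImp hi (fragVar B (n + 2)) (fragVar B 0)))
    (fragUnit hi ha)

/-- The operations of the translation in a fragment with implication. Variable `0` stands for
falsity, and variable `n + 1` for the negation of `n`. -/
def impOps (hi : .imp ∈ B) : TranslationOps (FragmentFormula B) :=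
  .ofImp (fragImp hi) (fragVar B 0) fun n => fragVar B (n + 1)

theorem isHom_eval_andOps (hi : .imp ∈ B) (ha : .and ∈ B)
    {coimp : FragmentFormula B → FragmentFormula B → FragmentFormula B}
    {A : Type u} [FLAlgebra A] (w : ℕ → A)
    (hc : ∀ φ ψ, (coimp φ ψ).1.eval w = ResiduatedLattice.coimp (φ.1.eval w) (ψ.1.eval w)) :
    (andOps hi ha coimp).IsHom (ResiduatedLattice.localOps (w 0) (w 1) fun n => w (n + 2))
      (fun φ => φ.1.eval w) := by
  have hu : (fragUnit hi ha).1.eval w = ResiduatedLattice.localUnit (w 0) (w 1) := rfl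
  refine ⟨fun φ ψ => congrArg (_ ⊓ ·) hu, fun φ ψ => congrArg₂ (· ⊓ ·) (hc φ ψ) hu, fun l => ?_,
    fun n => congrArg (_ ⊓ ·) hu⟩
  induction l with
  | nil => exact hu
  | cons φ l ih => exact congrArg (φ.1.eval w ⊓ ·) ih

theorem isHom_eval_impOps (hi : .imp ∈ B) {A : Type u} [FLAlgebra A] (w : ℕ → A) :
    (impOps hi).IsHom (.ofImp ResiduatedLattice.imp (w 0) fun n => w (n + 1))
      (fun φ => φ.1.eval w) where
  imp _ _ := rfl
  coimp _ _ := rfl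
  conj l := by
    refine congrArg (ResiduatedLattice.imp · (w 0)) ?_
    induction l with
    | nil => rfl
    | cons φ l ih => exact congrArg (ResiduatedLattice.imp (φ.1.eval w)) ih
  atom _ := rfl

open Classical in
theorem isHom_boolEval_andOps (hi : .imp ∈ B) (ha : .and ∈ B)
    {coimp : FragmentFormula B → FragmentFormula B → FragmentFormula B}
    (hc : ∀ w φ ψ, (coimp φ ψ).1.boolEval w = (φ.1.boolEval w || !ψ.1.boolEval w))
    (T : Set ℕ) :
    ∃ w, (andOps hi ha coimp).IsHom (.classical T) (fun φ => φ.1.boolEval w = true) := by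
  let w : ℕ → Bool := fun | 0 => false | 1 => true | n + 2 => decide (n ∉ T)
  have hu : (fragUnit hi ha).1.boolEval w = true := by
    simp [fragUnit, fragAnd, fragImp, fragVar, boolEval]
  refine ⟨w, fun φ ψ => ?_, fun ψ φ => ?_, fun l => ?_, fun n => ?_⟩
  · simp [andOps, TranslationOps.classical, fragAnd, fragImp, boolEval, hu, imp_iff_not_or]
  · simp [andOps, TranslationOps.classical, fragAnd, boolEval, hu, hc, imp_iff_or_not]
  · simp only [andOps, TranslationOps.classical, List.forall_mem_map]
    induction l with
    | nil => simpa using hu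
    | cons φ l ih =>
      simp only [List.forall_mem_cons, ← ih]
      simp [fragAnd, boolEval]
  · change ((((!true) || ((!decide (n ∉ T)) || false)) &&
      (fragUnit hi ha).1.boolEval w) = true) = (n ∈ T)
    simp [hu]

open Classical in
theorem isHom_boolEval_impOps (hi : .imp ∈ B) (T : Set ℕ) :
    ∃ w, (impOps hi).IsHom (.classical T) (fun φ => φ.1.boolEval w = true) := by
  let w : ℕ → Bool := fun | 0 => false | n + 1 => decide (n ∉ T)
  have hi' : ∀ φ ψ : FragmentFormula B,
      ((fragImp hi φ ψ).1.boolEval w = true) = (φ.1.boolEval w = true → ψ.1.boolEval w = true) := by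
    intro φ ψ
    simp [fragImp, boolEval, imp_iff_not_or]
  have h0 : ((fragVar B 0).1.boolEval w = true) = False := by simp [fragVar, boolEval, w]
  refine ⟨w, hi', fun ψ φ => hi' φ ψ, fun l => ?_, fun n => ?_⟩
  · simp only [impOps, TranslationOps.ofImp, TranslationOps.classical, hi', h0,
      List.forall_mem_map, eq_iff_iff]
    change ¬ _ ↔ _
    rw [not_iff_comm]
    induction l with
    | nil => simp [h0]
    | cons φ l ih =>
      simp only [List.forall_mem_cons, List.foldr_cons, hi', ← ih]
      tauto
  · change (((!decide (n ∉ T)) || false) = true) = (n ∈ T)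
    simp

end FLFormula

/-! ### Universality -/

namespace DeductiveSystem

/-- A countable system is a retract of its pullback along an enumeration of its formulas, so
universality need only be tested on systems over `ℕ`. -/
theorem isUniversal_of_nat {F : Type u} {L : DeductiveSystem F}
    (h : ∀ M : DeductiveSystem ℕ, M.Finitary → ∃ f, IsConservativeTranslation M L f) :
    IsUniversal.{u, v} L := by
  intro G _ M hM
  rcases isEmpty_or_nonempty G with hG | hG
  · exact ⟨isEmptyElim, fun _ φ => isEmptyElim φ⟩
  obtain ⟨e, he⟩ := exists_surjective_nat G
  let M' : DeductiveSystem ℕ :=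
    { entails := fun Γ n => M.entails (e '' Γ) (e n)
      refl := fun n => by
        rw [Set.image_singleton]
        exact M.refl _
      weaken := fun Γ Γ' n hn => by
        rw [Set.image_union]
        exact M.weaken _ _ _ hn
      cut := fun Γ Δ n hn hΔ => by
        refine M.cut _ _ _ hn ?_
        rintro _ ⟨m, hm, rfl⟩
        exact hΔ m hm }
  have hM' : M'.Finitary := by
    intro Γ n hn
    obtain ⟨Γ', hΓ', hfin, hent⟩ := hM _ _ hn
    obtain ⟨Δ, hΔ, hΔfin, rfl⟩ := (Set.exists_subset_image_finite_and
      (p := fun s => s = Γ')).1 ⟨Γ', hΓ', hfin, rfl⟩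
    exact ⟨Δ, hΔ, hΔfin, hent⟩
  obtain ⟨f, hf⟩ := h M' hM'
  refine ⟨f ∘ Function.surjInv he, fun Γ φ => ?_⟩
  rw [Set.image_comp]
  refine Iff.trans ?_ (hf _ _)
  change _ ↔ M.entails (e '' _) (e _)
  rw [← Set.image_comp, (Function.rightInverse_surjInv he).comp_eq_id, Set.image_id,
    Function.surjInv_eq he]

/-- Completeness of the translation needs only the bound `CPC`: the theory generated by `Γ` yields
a classical valuation in which the translations of exactly its members are true. -/
theorem isUniversal_of_conservativelyExtends {F : Type u} {L : DeductiveSystem F}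
    {B : Set FLConnective} {L₀ : DeductiveSystem (FragmentFormula B)}
    (hL : L.ConservativelyExtends L₀) (hCPC : L₀ ≤ CPC.fragment B)
    (S : TranslationOps (FragmentFormula B))
    (hS : ∀ T, ∃ w, S.IsHom (.classical T) (fun φ => φ.1.boolEval w = true))
    (k : DeductiveSystem ℕ → ℕ → ℕ) (hk : ∀ M n, 1 ≤ k M n)
    (hsound : ∀ (M : DeductiveSystem ℕ) (Γ : Set ℕ) (n : ℕ), Γ.Finite → M.entails Γ n →
      L₀.entails (S.translation M (k M) '' Γ) (S.translation M (k M) n)) :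
    IsUniversal.{u, v} L := by
  obtain ⟨e, he⟩ := hL
  refine isUniversal_of_nat fun M hM => ⟨e ∘ S.translation M (k M), fun Γ n => ?_⟩
  rw [Set.image_comp]
  refine Iff.trans ⟨fun h => ?_, fun h => ?_⟩ (he _ _)
  · obtain ⟨Γ', hΓ', hfin, h'⟩ := hM Γ n h
    exact L₀.entails_mono (Set.image_mono hΓ') (hsound M Γ' n hfin h')
  · obtain ⟨w, hw⟩ := hS {m | M.entails Γ m}
    have key : ∀ m, (S.translation M (k M) m).1.boolEval w = true ↔ M.entails Γ m := fun m =>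
      (hw.translation M (k M) m).to_iff.trans (TranslationOps.classical_translation
        (fun n hn => M.cut _ _ _ hn fun ψ hψ => hψ) (hk M) m)
    refine (key n).1 (hCPC _ _ h w ?_)
    rintro _ ⟨_, ⟨m, hm, rfl⟩, rfl⟩
    exact (key m).2 (M.entails_of_mem hm)

end DeductiveSystem

open FLFormula

/-- Soundness in the fragments with conjunction, for any class of algebras in which `coimp` defines
the backward implication. -/
theorem FLogic.entails_andOps {K : ∀ (A : Type) [FLAlgebra A], Prop} {B : Set FLConnective}
    (hi : .imp ∈ B) (ha : .and ∈ B)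
    {coimp : FragmentFormula B → FragmentFormula B → FragmentFormula B}
    (hc : ∀ (A : Type) [FLAlgebra A], K A → ∀ (w : ℕ → A) φ ψ,
      (coimp φ ψ).1.eval w = ResiduatedLattice.coimp (φ.1.eval w) (ψ.1.eval w))
    (M : DeductiveSystem ℕ) (Γ : Set ℕ) (n : ℕ) (hΓ : Γ.Finite) (hM : M.entails Γ n) :
    ((FLogic K).fragment B).entails ((andOps hi ha coimp).translation M (fun _ => 1) '' Γ)
      ((andOps hi ha coimp).translation M (fun _ => 1) n) := by
  intro A _ hA w hw
  have key : ∀ m, 1 ≤ ((andOps hi ha coimp).translation M (fun _ => 1) m).1.eval w ↔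
      1 ≤ (ResiduatedLattice.localPartOps (w 0) (w 1) fun n => w (n + 2)).translation M
        (fun _ => 1) m := by
    intro m
    rw [ResiduatedLattice.LocalPart.one_le_iff,
      (ResiduatedLattice.isHom_val_localPartOps _ _ _).translation,
      ← (isHom_eval_andOps hi ha w (hc A hA w)).translation]
  refine (key n).2 ((ResiduatedLattice.isSound_localPartOps _ _ _ M).one_le_translation hΓ hM ?_)
  exact fun i hi' => (key i).1 (hw _ ⟨_, ⟨i, hi', rfl⟩, rfl⟩)

theorem BCK_entails_impOps (M : DeductiveSystem ℕ) (Γ : Set ℕ) (n : ℕ) (hΓ : Γ.Finite)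
    (hM : M.entails Γ n) :
    BCK.entails ((impOps (Set.mem_singleton FLConnective.imp)).translation M M.exponent '' Γ)
      ((impOps (Set.mem_singleton FLConnective.imp)).translation M M.exponent n) := by
  intro A _ hA w hw
  let _ : CommMonoid A := { (inferInstance : Monoid A) with mul_comm := hA.1 }
  have key := (isHom_eval_impOps (Set.mem_singleton FLConnective.imp) w).translation M M.exponent
  have hS := TranslationOps.isSound_ofImp (X := A) ResiduatedLattice.le_imp_iff
    (fun a => (hA.2 a).2) (w 0) (fun n => w (n + 1)) M
  have h := hS.one_le_translation hΓ hM fun i hi => by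
    rw [← key]
    exact hw _ ⟨_, ⟨i, hi, rfl⟩, rfl⟩
  rwa [← key] at h

theorem mainTheorem3 {F : Type u} (L : DeductiveSystem F)
    (h :
      (∃ L₀ : DeductiveSystem
          (FragmentFormula {FLConnective.imp, FLConnective.coimp, FLConnective.and}),
        FL.fragment {FLConnective.imp, FLConnective.coimp, FLConnective.and} ≤ L₀ ∧
        L₀ ≤ CPC.fragment {FLConnective.imp, FLConnective.coimp, FLConnective.and} ∧
        L.ConservativelyExtends L₀) ∨
      (∃ L₀ : DeductiveSystem (FragmentFormula {FLConnective.imp, FLConnective.and}),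
        FLe.fragment {FLConnective.imp, FLConnective.and} ≤ L₀ ∧
        L₀ ≤ CPC.fragment {FLConnective.imp, FLConnective.and} ∧
        L.ConservativelyExtends L₀) ∨
      (∃ L₀ : DeductiveSystem (FragmentFormula {FLConnective.imp}),
        BCK ≤ L₀ ∧
        L₀ ≤ CPC.fragment {FLConnective.imp} ∧
        L.ConservativelyExtends L₀)) :
    DeductiveSystem.IsUniversal.{u, v} L := by
  rcases h with ⟨L₀, hle, hCPC, hL⟩ | ⟨L₀, hle, hCPC, hL⟩ | ⟨L₀, hle, hCPC, hL⟩
  · have hi : FLConnective.imp ∈ ({.imp, .coimp, .and} : Set FLConnective) := by simp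
    have hc : FLConnective.coimp ∈ ({.imp, .coimp, .and} : Set FLConnective) := by simp
    have ha : FLConnective.and ∈ ({.imp, .coimp, .and} : Set FLConnective) := by simp
    refine isUniversal_of_conservativelyExtends hL hCPC
      (andOps hi ha fun φ ψ => ⟨coimp φ.1 ψ.1, hc, φ.2, ψ.2⟩)
      (isHom_boolEval_andOps hi ha fun _ _ _ => rfl) (fun _ _ => 1) (fun _ _ => le_rfl) ?_
    exact fun M Γ n hΓ hM =>
      hle _ _ (FLogic.entails_andOps hi ha (fun _ _ _ _ _ _ => rfl) M Γ n hΓ hM)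
  · have hi : FLConnective.imp ∈ ({.imp, .and} : Set FLConnective) := by simp
    have ha : FLConnective.and ∈ ({.imp, .and} : Set FLConnective) := by simp
    -- In commutative algebras the two implications coincide.
    refine isUniversal_of_conservativelyExtends hL hCPC
      (andOps hi ha fun φ ψ => fragImp hi ψ φ)
      (isHom_boolEval_andOps hi ha fun _ _ _ => Bool.or_comm _ _) (fun _ _ => 1)
      (fun _ _ => le_rfl) ?_
    refine fun M Γ n hΓ hM => hle _ _ (FLogic.entails_andOps hi ha ?_ M Γ n hΓ hM)
    intro A _ hA w φ ψ
    refine eq_of_forall_le_iff fun a => ?_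
    rw [ResiduatedLattice.le_coimp_iff, hA]
    exact ResiduatedLattice.le_imp_iff _ _ _
  · exact isUniversal_of_conservativelyExtends hL hCPC (impOps (Set.mem_singleton _))
      (isHom_boolEval_impOps _) exponent one_le_exponent
      fun M Γ n hΓ hM => hle _ _ (BCK_entails_impOps M Γ n hΓ hM)
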